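/- An instance $\Phi$ of (uniform) MAX NAE-SAT consists of Boolean variables $x_1,\dots,x_n$ and a nonempty finite list of clauses; a clause is a tuple of $\ell\ge 2$ literals on distinct variables, with a positive weight (an integer written in binary; rational weights reduce to this by clearing denominators), and an assignment satisfies it if the $\ell$ literals do not all take the same value. The length $\ell$ of a clause is arbitrary, so it may grow with $n$; MAX NAE-$[k]$-SAT is the restriction to instances all of whose clauses have length at most $k$. The value of an assignment is the weighted fraction of the clauses that it satisfies, and the optimal value of $\Phi$ is the maximum of this over all assignments. For a class $\Lambda$ of such instances and $c\in[0,1]$, let $U_\Lambda(c)$ be the best soundness achievable in polynomial time on instances of completeness $c$: the supremum of all $s\in[0,1]$ for which there is a randomized algorithm (with fair coin tosses) that runs in polynomial time on every instance in $\Lambda$ and that, on every instance $\Phi\in\Lambda$ with optimal value at least $c$, outputs an assignment whose expected value is at least $s$. Write $U$ for $U_\Lambda$ when $\Lambda$ is uniform MAX NAE-SAT, and $U_k$ when $\Lambda$ is MAX NAE-$[k]$-SAT. **Lemma.** For all $c\in[0,1]$, the limit of $U_k(c)$ as $k\to\infty$ exists, and $$U(c)=\lim_{k\to\infty}U_k(c).$$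 -/

import Mathlib

open Filter Topology

/-! ### Weighted MAX NAE-SAT -/

namespace MaxNAE

/-- A weighted not-all-equal clause on the variables `0, …, n - 1`: a positive weight, written in
binary in the input (rational weights are brought to this form by clearing denominators), and a
tuple of at least two literals on distinct variables.  The literal `(i, b)` is the variable `i`
if `b = false`, and its negation if `b = true`.  Truth values are `Bool` in place of `{-1, 1}`. -/
structure Clause (n : ℕ) where
  weight : ℕ
  weight_pos : 0 < weight
  lits : List (Fin n × Bool)
  two_le_length : 2 ≤ lits.length
  nodup : (lits.map Prod.fst).Nodup

/-- The value of a literal under an assignment. -/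
def litValue {n : ℕ} (x : Fin n → Bool) (l : Fin n × Bool) : Bool :=
  xor l.2 (x l.1)

/-- The clause is satisfied iff its literals do not all take the same value. -/
def Clause.Sat {n : ℕ} (C : Clause n) (x : Fin n → Bool) : Prop :=
  ¬ ∀ l ∈ C.lits, ∀ l' ∈ C.lits, litValue x l = litValue x l'

instance {n : ℕ} (C : Clause n) (x : Fin n → Bool) : Decidable (C.Sat x) := by
  unfold Clause.Sat
  infer_instance

/-- An instance of MAX NAE-SAT: a number of variables and a nonempty finite collection of
weighted clauses, whose lengths are not bounded in advance. -/
structure Instance where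
  numVars : ℕ
  clauses : List (Clause numVars)
  clauses_ne_nil : clauses ≠ []

namespace Instance

def totalWeight (Φ : Instance) : ℕ :=
  (Φ.clauses.map Clause.weight).sum

def satWeight (Φ : Instance) (x : Fin Φ.numVars → Bool) : ℕ :=
  ((Φ.clauses.filter fun C => C.Sat x).map Clause.weight).sum

/-- The weighted fraction of the clauses that `x` satisfies. -/
noncomputable def value (Φ : Instance) (x : Fin Φ.numVars → Bool) : ℝ :=
  (Φ.satWeight x : ℝ) / (Φ.totalWeight : ℝ)

/-- The optimal value of an instance (a maximum over finitely many assignments). -/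
noncomputable def opt (Φ : Instance) : ℝ :=
  ⨆ x : Fin Φ.numVars → Bool, Φ.value x

end Instance

/-- The instances of uniform MAX NAE-SAT: clauses of all lengths. -/
def uniformNAE : Set Instance :=
  Set.univ

/-- The instances of MAX NAE-`[k]`-SAT: every clause has length at most `k`. -/
def boundedNAE (k : ℕ) : Set Instance :=
  {Φ | ∀ C ∈ Φ.clauses, C.lits.length ≤ k}

/-! ### A probabilistic machine model with a step count

Programs are those of the textbook WHILE language over binary trees (Lisp-style data built by
`cons` from `nil`), with coin tossing added.  Trees are kept as pointers to shared cells, so that a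
step of a fixed program is a bounded number of pointer operations; polynomial time in this model
is (probabilistic) polynomial time on Turing machines. -/

/-- Data: binary trees with unlabelled nodes. -/
abbrev Data : Type :=
  BinaryTree Unit

def Data.cons (a b : Data) : Data :=
  BinaryTree.node () a b

/-- The contents of the registers, which are numbered `0, 1, 2, …`; a program mentions only
finitely many of them. -/
abbrev Store : Type :=
  ℕ → Data

inductive Expr : Type
  | nil : Expr
  | var : ℕ → Expr
  | cons : Expr → Expr → Expr
  | hd : Expr → Expr
  | tl : Expr → Expr

/-- The value of an expression; the head and the tail of `nil` are `nil`. -/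
def Expr.eval (s : Store) : Expr → Data
  | nil => BinaryTree.nil
  | var x => s x
  | cons e f => Data.cons (e.eval s) (f.eval s)
  | hd e => (e.eval s).left
  | tl e => (e.eval s).right

/-- Programs: do nothing; assign the value of an expression to a register; run two programs one
after the other; branch on whether an expression is different from `nil`; repeat a program while
an expression is different from `nil`; put the outcome of a fair coin toss into a register. -/
inductive Program : Type
  | skip : Program
  | assign : ℕ → Expr → Program
  | seq : Program → Program → Program
  | cond : Expr → Program → Program → Program
  | loop : Expr → Program → Program
  | flip : ℕ → Program

/-- A configuration: the programs that remain to be run, in order, and the store. -/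
abbrev Config : Type :=
  List Program × Store

/-- The representation of truth values as trees. -/
def Data.ofBool : Bool → Data
  | false => BinaryTree.nil
  | true => Data.cons BinaryTree.nil BinaryTree.nil

/-- One step of the computation, where `b` is the outcome of the coin tossed at this step; only
`flip` looks at it.  The configurations with nothing left to run are the halted ones. -/
def step (b : Bool) : Config → Config
  | ([], s) => ([], s)
  | (Program.skip :: k, s) => (k, s)
  | (Program.assign x e :: k, s) => (k, Function.update s x (e.eval s))
  | (Program.seq p q :: k, s) => (p :: q :: k, s)
  | (Program.cond e p q :: k, s) =>
      if e.eval s ≠ BinaryTree.nil then (p :: k, s) else (q :: k, s)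
  | (Program.loop e p :: k, s) =>
      if e.eval s ≠ BinaryTree.nil then (p :: Program.loop e p :: k, s) else (k, s)
  | (Program.flip x :: k, s) => (k, Function.update s x (Data.ofBool b))

/-- The initial configuration: the input is in register `0`, all other registers hold `nil`. -/
def start (P : Program) (d : Data) : Config :=
  ([P], Function.update (fun _ => BinaryTree.nil) 0 d)

/-- The configuration after `T` steps on input `d`, where `r` lists the coin tosses. -/
def runFor (P : Program) (d : Data) (T : ℕ) (r : Fin T → Bool) : Config :=
  (List.ofFn r).foldl (fun C b => step b C) (start P d)

/-- Whatever the coin tosses, `P` halts on input `d` within `T` steps. -/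
def HaltsWithin (P : Program) (d : Data) (T : ℕ) : Prop :=
  ∀ r : Fin T → Bool, (runFor P d T r).1 = []

/-! ### Input and output -/

/-- A list, as a right comb. -/
def Data.ofList : List Data → Data
  | [] => BinaryTree.nil
  | a :: l => Data.cons a (Data.ofList l)

def Data.unary (m : ℕ) : Data :=
  Data.ofList (List.replicate m BinaryTree.nil)

/-- Binary notation, least significant digit first. -/
def Data.binary (m : ℕ) : Data :=
  Data.ofList (m.bits.map Data.ofBool)

/-- The variable number is in unary; since an instance has a variable set listed in the input,
this is polynomially equivalent to any other usual encoding. -/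
def encodeLit {n : ℕ} (l : Fin n × Bool) : Data :=
  Data.cons (Data.unary l.1) (Data.ofBool l.2)

def encodeClause {n : ℕ} (C : Clause n) : Data :=
  Data.cons (Data.binary C.weight) (Data.ofList (C.lits.map encodeLit))

def encode (Φ : Instance) : Data :=
  Data.cons (Data.unary Φ.numVars) (Data.ofList (Φ.clauses.map encodeClause))

/-- The size of an instance: the number of nodes of the input tree. -/
def size (Φ : Instance) : ℕ :=
  (encode Φ).numNodes

/-- A tree read as an assignment: variable `i` is true iff the `i`-th list entry is not `nil`. -/
def decodeAssignment (n : ℕ) (d : Data) : Fin n → Bool :=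
  fun i => decide ((BinaryTree.right^[(i : ℕ)] d).left ≠ BinaryTree.nil)

/-- The assignment in register `0` after `T` steps on the instance `Φ`. -/
def output (P : Program) (Φ : Instance) (T : ℕ) (r : Fin T → Bool) : Fin Φ.numVars → Bool :=
  decodeAssignment Φ.numVars ((runFor P (encode Φ) T r).2 0)

/-- The expected value of the assignment computed by `P` on the instance `Φ` after `T` steps, over
`T` independent fair coin tosses. -/
noncomputable def expectedValue (P : Program) (Φ : Instance) (T : ℕ) : ℝ :=
  (∑ r : Fin T → Bool, Φ.value (output P Φ T r)) / 2 ^ T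

/-! ### Best achievable soundness -/

/-- A randomized polynomial-time algorithm for the problem `Λ` finds, on each instance in `Λ` of
completeness at least `c`, an assignment of expected value at least `s`. -/
def Achieves (Λ : Set Instance) (c s : ℝ) : Prop :=
  ∃ (P : Program) (time : Polynomial ℕ),
    (∀ Φ ∈ Λ, HaltsWithin P (encode Φ) (time.eval (size Φ))) ∧
    ∀ Φ ∈ Λ, c ≤ Φ.opt → s ≤ expectedValue P Φ (time.eval (size Φ))

/-- The best soundness achievable in polynomial time for the problem `Λ` at completeness `c`. -/
noncomputable def bestSoundness (Λ : Set Instance) (c : ℝ) : ℝ :=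
  sSup {s : ℝ | s ∈ Set.Icc (0 : ℝ) 1 ∧ Achieves Λ c s}

end MaxNAE

/-!
Clauses of bounded length are a special case, so the best soundness `U_k(c)` decreases in `k` and is
at least the best soundness `U(c)` for all lengths.  Conversely, for every `ε > 0` there is a `K`
with `U_K(c) ≤ U(c) + ε` (`GoodNoise.bestSoundness_le`), which gives the limit.

An algorithm `P` for clauses of length at most `K` is turned into one for all lengths as follows.
Every clause longer than `K` is replaced by the clause on two additional variables, the same for all
of them, of the same weight.  The optimal value does not decrease, as the two variables can be given
different values (`Instance.opt_le_opt_shorten`).  Then `P` is run, the additional variables are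
forgotten, and each remaining variable is negated independently with a small probability `δ`.

* A clause satisfied by the output of `P` has two literals of different values.  With probability at
  least `1 - 2 * δ` neither is negated, whatever the length (`Clause.Sat.le_coinProb_perturb`).
* A clause of length `ℓ` is satisfied after the perturbation with probability at least
  `1 - 2 * (1 - δ) ^ ℓ`, whatever the output of `P` (`Clause.le_coinProb_perturb`).

With `2 * δ ≤ ε` and `2 * (1 - δ) ^ K ≤ ε` the expected value drops by at most `ε`
(`GoodNoise.value`); with `δ = 2 ^ (-j)` the perturbation needs only fair coins.

That this is a polynomial-time program is checked with a quantitative program logic.  The predicate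
`Guarantees T C f v` bounds the running time of a configuration and the expectation of `f` at its
final store together, and has one rule for each program construct.  The rule `Guarantees.frame` runs
the given `P` inside the larger program, whose own registers lie beyond those that `P` mentions.
-/

namespace MaxNAE

/-! ### Runs with a guaranteed expectation -/

/-- Whatever the coin tosses, `C` halts within `T` steps, and the expectation of `f` at the final
store is at least `v`. -/
def Guarantees : ℕ → Config → (Store → ℝ) → ℝ → Prop
  | 0, C, f, v => C.1 = [] ∧ v ≤ f C.2
  | T + 1, C, f, v => ∃ v₀ v₁, Guarantees T (step false C) f v₀ ∧
      Guarantees T (step true C) f v₁ ∧ v ≤ (v₀ + v₁) / 2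

theorem sum_fin_succ_bool {M : Type*} [AddCommMonoid M] (T : ℕ)
    (g : (Fin (T + 1) → Bool) → M) :
    ∑ r, g r =
      ∑ r : Fin T → Bool, g (Fin.cons false r) + ∑ r : Fin T → Bool, g (Fin.cons true r) := by
  rw [← (Fin.consEquiv fun _ : Fin (T + 1) => Bool).sum_comp, Fintype.sum_prod_type,
    Fintype.sum_bool, add_comm]
  rfl

/-- The step-by-step definition of a guarantee amounts to the one by a finite sample space. -/
theorem guarantees_iff {T : ℕ} {C : Config} {f : Store → ℝ} {v : ℝ} :
    Guarantees T C f v ↔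
      (∀ r : Fin T → Bool, ((List.ofFn r).foldl (fun C b => step b C) C).1 = []) ∧
      v ≤ (∑ r : Fin T → Bool, f ((List.ofFn r).foldl (fun C b => step b C) C).2) / 2 ^ T := by
  induction T generalizing C v with
  | zero => simp [Guarantees]
  | succ T ih =>
    simp only [Guarantees, ih, sum_fin_succ_bool, List.ofFn_succ, List.foldl_cons, Fin.cons_zero,
      Fin.cons_succ]
    constructor
    · rintro ⟨v₀, v₁, ⟨h₀, h₀'⟩, ⟨h₁, h₁'⟩, hv⟩
      refine ⟨fun r => ?_, hv.trans ?_⟩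
      · cases hr : r 0
        · exact h₀ _
        · exact h₁ _
      · rw [pow_succ, ← div_div]
        refine div_le_div_of_nonneg_right ?_ zero_le_two
        rw [add_div]
        exact add_le_add h₀' h₁'
    · rintro ⟨h, hv⟩
      refine ⟨_, _, ⟨fun r => ?_, le_rfl⟩, ⟨fun r => ?_, le_rfl⟩, ?_⟩
      · simpa using h (Fin.cons false r)
      · simpa using h (Fin.cons true r)
      · rwa [pow_succ, ← div_div, add_div _ _ (2 ^ T)] at hv

namespace Guarantees

variable {T T' : ℕ} {C : Config} {k : List Program} {s : Store} {f : Store → ℝ} {v v' : ℝ}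

theorem mono_value (h : Guarantees T C f v) (hv : v' ≤ v) : Guarantees T C f v' := by
  cases T with
  | zero => exact ⟨h.1, hv.trans h.2⟩
  | succ T =>
    obtain ⟨v₀, v₁, h₀, h₁, h⟩ := h
    exact ⟨v₀, v₁, h₀, h₁, hv.trans h⟩

theorem step_halted (b : Bool) (s : Store) : step b ([], s) = ([], s) := by
  simp [step]

theorem halted (h : v ≤ f s) : Guarantees T ([], s) f v := by
  induction T with
  | zero => exact ⟨rfl, h⟩
  | succ T ih =>
    refine ⟨v, v, ?_, ?_, by linarith⟩ <;> rwa [step_halted]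

theorem succ_time (h : Guarantees T C f v) : Guarantees (T + 1) C f v := by
  induction T generalizing C v with
  | zero =>
    obtain ⟨k, s⟩ := C
    obtain ⟨rfl, h⟩ := h
    exact halted h
  | succ T ih =>
    obtain ⟨v₀, v₁, h₀, h₁, h⟩ := h
    exact ⟨v₀, v₁, ih h₀, ih h₁, h⟩

theorem mono_time (h : Guarantees T C f v) (hT : T ≤ T') : Guarantees T' C f v := by
  induction hT with
  | refl => exact h
  | step _ ih => exact ih.succ_time

theorem of_step {C' : Config} (hC : ∀ b, step b C = C') (h : Guarantees T C' f v) :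
    Guarantees (T + 1) C f v :=
  ⟨v, v, by rwa [hC], by rwa [hC], by linarith⟩

theorem skip (h : Guarantees T (k, s) f v) : Guarantees (T + 1) (Program.skip :: k, s) f v :=
  of_step (fun _ => by simp [step]) h

theorem assign {x : ℕ} {e : Expr} (h : Guarantees T (k, Function.update s x (e.eval s)) f v) :
    Guarantees (T + 1) (Program.assign x e :: k, s) f v :=
  of_step (fun _ => by simp [step]) h

theorem seq {p q : Program} (h : Guarantees T (p :: q :: k, s) f v) :
    Guarantees (T + 1) (Program.seq p q :: k, s) f v :=
  of_step (fun _ => by simp [step]) h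

theorem cond_pos {e : Expr} {p q : Program} (he : e.eval s ≠ BinaryTree.nil)
    (h : Guarantees T (p :: k, s) f v) : Guarantees (T + 1) (Program.cond e p q :: k, s) f v :=
  of_step (fun _ => by simp [step, he]) h

theorem cond_neg {e : Expr} {p q : Program} (he : e.eval s = BinaryTree.nil)
    (h : Guarantees T (q :: k, s) f v) : Guarantees (T + 1) (Program.cond e p q :: k, s) f v :=
  of_step (fun _ => by simp [step, he]) h

theorem loop_pos {e : Expr} {p : Program} (he : e.eval s ≠ BinaryTree.nil)
    (h : Guarantees T (p :: Program.loop e p :: k, s) f v) :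
    Guarantees (T + 1) (Program.loop e p :: k, s) f v :=
  of_step (fun _ => by simp [step, he]) h

theorem loop_neg {e : Expr} {p : Program} (he : e.eval s = BinaryTree.nil)
    (h : Guarantees T (k, s) f v) : Guarantees (T + 1) (Program.loop e p :: k, s) f v :=
  of_step (fun _ => by simp [step, he]) h

theorem flip {x : ℕ} {v₀ v₁ : ℝ}
    (h₀ : Guarantees T (k, Function.update s x (Data.ofBool false)) f v₀)
    (h₁ : Guarantees T (k, Function.update s x (Data.ofBool true)) f v₁) :
    Guarantees (T + 1) (Program.flip x :: k, s) f ((v₀ + v₁) / 2) :=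
  ⟨v₀, v₁, by simpa [step] using h₀, by simpa [step] using h₁, le_rfl⟩

end Guarantees

/-! ### Running a program inside another one -/

/-- The expression mentions only registers up to `R`. -/
def Expr.Bounded (R : ℕ) : Expr → Prop
  | nil => True
  | var x => x ≤ R
  | cons e f => e.Bounded R ∧ f.Bounded R
  | hd e => e.Bounded R
  | tl e => e.Bounded R

/-- The program mentions only registers up to `R`. -/
def Program.Bounded (R : ℕ) : Program → Prop
  | skip => True
  | assign x e => x ≤ R ∧ e.Bounded R
  | seq p q => p.Bounded R ∧ q.Bounded R
  | cond e p q => e.Bounded R ∧ p.Bounded R ∧ q.Bounded R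
  | loop e p => e.Bounded R ∧ p.Bounded R
  | flip x => x ≤ R

theorem Expr.Bounded.mono {R R' : ℕ} (hR : R ≤ R') {e : Expr} (h : e.Bounded R) :
    e.Bounded R' := by
  induction e with
  | nil => trivial
  | var x => exact le_trans h hR
  | cons e f ihe ihf => exact ⟨ihe h.1, ihf h.2⟩
  | hd e ih => exact ih h
  | tl e ih => exact ih h

theorem Program.Bounded.mono {R R' : ℕ} (hR : R ≤ R') {p : Program} (h : p.Bounded R) :
    p.Bounded R' := by
  induction p with
  | skip => trivial
  | assign x e => exact ⟨h.1.trans hR, h.2.mono hR⟩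
  | seq p q ihp ihq => exact ⟨ihp h.1, ihq h.2⟩
  | cond e p q ihp ihq => exact ⟨h.1.mono hR, ihp h.2.1, ihq h.2.2⟩
  | loop e p ih => exact ⟨h.1.mono hR, ih h.2⟩
  | flip x => exact le_trans h hR

theorem Expr.exists_bounded (e : Expr) : ∃ R, e.Bounded R := by
  induction e with
  | nil => exact ⟨0, trivial⟩
  | var x => exact ⟨x, le_refl x⟩
  | cons e f ihe ihf =>
    obtain ⟨R, hR⟩ := ihe
    obtain ⟨R', hR'⟩ := ihf
    exact ⟨max R R', hR.mono (le_max_left _ _), hR'.mono (le_max_right _ _)⟩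
  | hd e ih => exact ih
  | tl e ih => exact ih

theorem Program.exists_bounded (p : Program) : ∃ R, p.Bounded R := by
  induction p with
  | skip => exact ⟨0, trivial⟩
  | assign x e =>
    obtain ⟨R, hR⟩ := e.exists_bounded
    exact ⟨max x R, le_max_left _ _, hR.mono (le_max_right _ _)⟩
  | seq p q ihp ihq =>
    obtain ⟨R, hR⟩ := ihp
    obtain ⟨R', hR'⟩ := ihq
    exact ⟨max R R', hR.mono (le_max_left _ _), hR'.mono (le_max_right _ _)⟩
  | cond e p q ihp ihq =>
    obtain ⟨R, hR⟩ := ihp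
    obtain ⟨R', hR'⟩ := ihq
    obtain ⟨R'', hR''⟩ := e.exists_bounded
    exact ⟨max R'' (max R R'), hR''.mono (le_max_left _ _),
      hR.mono ((le_max_left _ _).trans (le_max_right _ _)),
      hR'.mono ((le_max_right _ _).trans (le_max_right _ _))⟩
  | loop e p ih =>
    obtain ⟨R, hR⟩ := ih
    obtain ⟨R', hR'⟩ := e.exists_bounded
    exact ⟨max R R', hR'.mono (le_max_right _ _), hR.mono (le_max_left _ _)⟩
  | flip x => exact ⟨x, le_refl x⟩

theorem Expr.Bounded.eval_congr {R : ℕ} {e : Expr} (h : e.Bounded R) {s t : Store}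
    (hst : ∀ i ≤ R, s i = t i) : e.eval s = e.eval t := by
  induction e with
  | nil => rfl
  | var x => exact hst x h
  | cons e f ihe ihf => simp only [Expr.eval, ihe h.1, ihf h.2]
  | hd e ih => simp only [Expr.eval, ih h]
  | tl e ih => simp only [Expr.eval, ih h]

/-- Framing: a guarantee for bounded programs run on a store `s₀` carries over to a store `s` that
agrees with `s₀` up to register `R`, with further programs `k` to be run afterwards; the registers
beyond `R` are left alone, so `k` finds there what `s` held. -/
theorem Guarantees.frame {R T T' : ℕ} {k₀ k : List Program} {s₀ s : Store} {f g : Store → ℝ}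
    {v : ℝ} (h : Guarantees T (k₀, s₀) g v) (hk₀ : ∀ p ∈ k₀, p.Bounded R)
    (hs : ∀ i ≤ R, s i = s₀ i)
    (hk : ∀ s₀' s' : Store, (∀ i ≤ R, s' i = s₀' i) → (∀ i, R < i → s' i = s i) →
      Guarantees T' (k, s') f (g s₀')) :
    Guarantees (T + T') (k₀ ++ k, s) f v := by
  induction T generalizing k₀ s₀ s v with
  | zero =>
    obtain ⟨rfl, h⟩ := h
    simpa using (hk s₀ s hs fun _ _ => rfl).mono_value h
  | succ T ih =>
    obtain ⟨v₀, v₁, h₀, h₁, hv⟩ := h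
    -- Updating the same register up to `R` in both stores preserves the relation between them.
    have upd : ∀ (x : ℕ) (d d' : Data), d = d' → x ≤ R →
        (∀ i ≤ R, Function.update s x d i = Function.update s₀ x d' i) ∧
        ∀ i, R < i → Function.update s x d i = s i := by
      rintro x d _ rfl hx
      refine ⟨fun i hi => ?_, fun i hi => Function.update_of_ne (by omega) _ _⟩
      by_cases hix : i = x
      · simp [hix]
      · simp [hix, hs i hi]
    -- The steps that do not depend on the coin.
    have det : ∀ (k₁ : List Program) (s₁ t₁ : Store), (∀ b, step b (k₀, s₀) = (k₁, s₁)) →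
        (∀ b, step b (k₀ ++ k, s) = (k₁ ++ k, t₁)) → (∀ p ∈ k₁, p.Bounded R) →
        (∀ i ≤ R, t₁ i = s₁ i) → (∀ i, R < i → t₁ i = s i) →
        Guarantees (T + 1 + T') (k₀ ++ k, s) f v := by
      intro k₁ s₁ t₁ hst hst' hb hlow hhigh
      rw [hst] at h₀ h₁
      have hk' : ∀ s₀' s' : Store, (∀ i ≤ R, s' i = s₀' i) → (∀ i, R < i → s' i = t₁ i) →
          Guarantees T' (k, s') f (g s₀') := fun s₀' s' h1 h2 =>
        hk s₀' s' h1 fun i hi => (h2 i hi).trans (hhigh i hi)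
      rw [Nat.add_right_comm]
      exact ⟨v₀, v₁, by rw [hst']; exact ih h₀ hb hlow hk',
        by rw [hst']; exact ih h₁ hb hlow hk', hv⟩
    cases k₀ with
    | nil =>
      rw [step_halted] at h₀ h₁
      have h₀' := ih h₀ hk₀ hs hk
      have h₁' := ih h₁ hk₀ hs hk
      rw [Nat.add_right_comm]
      refine Guarantees.succ_time ?_
      rcases le_total v₀ v₁ with h | h
      · exact h₁'.mono_value (by linarith)
      · exact h₀'.mono_value (by linarith)
    | cons p k₁ =>
      have hp : p.Bounded R := hk₀ p (by simp)
      have hk₁ : ∀ q ∈ k₁, q.Bounded R := fun q hq => hk₀ q (by simp [hq])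
      cases p with
      | skip =>
        exact det k₁ s₀ s (fun _ => by simp [step]) (fun _ => by simp [step]) hk₁ hs
          fun _ _ => rfl
      | assign x e =>
        exact det k₁ _ _ (fun _ => by simp [step]) (fun _ => by simp [step]) hk₁
          (upd x _ _ (hp.2.eval_congr hs) hp.1).1 (upd x _ _ (hp.2.eval_congr hs) hp.1).2
      | seq p q =>
        refine det (p :: q :: k₁) s₀ s (fun _ => by simp [step]) (fun _ => by simp [step]) ?_ hs
          fun _ _ => rfl
        simpa [hp.1, hp.2] using hk₁
      | cond e p q =>
        have he := hp.1.eval_congr hs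
        by_cases hn : e.eval s₀ = BinaryTree.nil
        · refine det (q :: k₁) s₀ s (fun _ => by simp [step, hn])
            (fun _ => by simp [step, he, hn]) ?_ hs fun _ _ => rfl
          simpa [hp.2.2] using hk₁
        · refine det (p :: k₁) s₀ s (fun _ => by simp [step, hn])
            (fun _ => by simp [step, he, hn]) ?_ hs fun _ _ => rfl
          simpa [hp.2.1] using hk₁
      | loop e p =>
        have he := hp.1.eval_congr hs
        by_cases hn : e.eval s₀ = BinaryTree.nil
        · exact det k₁ s₀ s (fun _ => by simp [step, hn])
            (fun _ => by simp [step, he, hn]) hk₁ hs fun _ _ => rfl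
        · refine det (p :: Program.loop e p :: k₁) s₀ s (fun _ => by simp [step, hn])
            (fun _ => by simp [step, he, hn]) ?_ hs fun _ _ => rfl
          rintro q hq
          rcases List.mem_cons.1 hq with rfl | hq
          · exact hp.2
          rcases List.mem_cons.1 hq with rfl | hq
          · exact hp
          · exact hk₁ q hq
      | flip x =>
        have key : ∀ (b : Bool) (w : ℝ), Guarantees T (step b (Program.flip x :: k₁, s₀)) g w →
            Guarantees (T + T') (step b (Program.flip x :: k₁ ++ k, s)) f w := by
          intro b w hw
          have hu := upd x (Data.ofBool b) _ rfl hp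
          simp only [step, List.cons_append] at hw ⊢
          exact ih hw hk₁ hu.1 fun s₀' s' h1 h2 =>
            hk s₀' s' h1 fun i hi => (h2 i hi).trans (hu.2 i hi)
        rw [Nat.add_right_comm]
        exact ⟨v₀, v₁, key false v₀ h₀, key true v₁ h₁, hv⟩

/-! ### Replacing the long clauses -/

/-- The clause in which the variables `0, …, n - 1` are kept if the length is at most `K`; a longer
clause becomes the clause on the two additional variables `n` and `n + 1`, of the same weight. -/
def Clause.shorten {n : ℕ} (K : ℕ) (C : Clause n) : Clause (n + 2) where
  weight := C.weight
  weight_pos := C.weight_pos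
  lits := if C.lits.length ≤ K then C.lits.map fun l => (Fin.castAdd 2 l.1, l.2)
    else [(Fin.natAdd n 0, false), (Fin.natAdd n 1, false)]
  two_le_length := by
    have := C.two_le_length
    split_ifs <;> simp [this]
  nodup := by
    split_ifs
    · have h := C.nodup.map (Fin.castAdd_injective n 2)
      simpa [List.map_map, Function.comp_def] using h
    · simp

theorem Clause.length_shorten_le {n K : ℕ} (hK : 2 ≤ K) (C : Clause n) :
    (C.shorten K).lits.length ≤ K := by
  simp only [Clause.shorten]
  split_ifs with h <;> simp [h, hK]

/-- All long clauses are replaced by clauses on the same two additional variables.  The order of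
the clauses is reversed, since the program that computes the new instance collects them on a
stack. -/
def Instance.shorten (K : ℕ) (Φ : Instance) : Instance where
  numVars := Φ.numVars + 2
  clauses := (Φ.clauses.map (Clause.shorten K)).reverse
  clauses_ne_nil := by simpa using Φ.clauses_ne_nil

theorem Instance.shorten_mem_boundedNAE {K : ℕ} (hK : 2 ≤ K) (Φ : Instance) :
    Φ.shorten K ∈ boundedNAE K := by
  intro C hC
  obtain ⟨D, -, rfl⟩ := List.mem_map.1 (List.mem_reverse.1 hC)
  exact D.length_shorten_le hK

theorem Data.cons_ne_nil (a b : Data) : Data.cons a b ≠ BinaryTree.nil := by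
  simp [Data.cons]

theorem Data.unary_succ (m : ℕ) :
    Data.unary (m + 1) = Data.cons BinaryTree.nil (Data.unary m) := rfl

/-- The list of literals of the clauses that replace long ones, read off from the number `n` of
variables, which is in register `r`. -/
def freshLits (r : ℕ) : Expr :=
  .cons (.cons (.var r) .nil) (.cons (.cons (.cons .nil (.var r)) .nil) .nil)

theorem encodeClause_shorten {n : ℕ} (K : ℕ) (C : Clause n) :
    encodeClause (C.shorten K) = if C.lits.length ≤ K then encodeClause C else
      Data.cons (Data.binary C.weight) (Data.ofList
        [Data.cons (Data.unary n) BinaryTree.nil,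
          Data.cons (Data.unary (n + 1)) BinaryTree.nil]) := by
  simp only [encodeClause, Clause.shorten]
  split_ifs
  · simp only [List.map_map]
    rfl
  · simp [encodeLit, Data.ofBool]

theorem Expr.eval_tl_iterate (s : Store) (e : Expr) (K : ℕ) :
    (Expr.tl^[K] e).eval s = BinaryTree.right^[K] (e.eval s) := by
  induction K with
  | zero => rfl
  | succ K ih => simp only [Function.iterate_succ_apply', Expr.eval, ih]

theorem Data.right_iterate_ofList (l : List Data) (K : ℕ) :
    BinaryTree.right^[K] (Data.ofList l) = Data.ofList (l.drop K) := by
  induction K generalizing l with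
  | zero => rfl
  | succ K ih =>
    cases l with
    | nil =>
      have := ih []
      simpa [Data.ofList, BinaryTree.right] using this
    | cons a l => simpa [Data.ofList, Data.cons, BinaryTree.right] using ih l

theorem Data.ofList_eq_nil {l : List Data} : Data.ofList l = BinaryTree.nil ↔ l = [] := by
  cases l <;> simp [Data.ofList, Data.cons]

/-- Move the first clause from the list in register `R + 1` to the list in register `R + 2`, with
new literals if it is long; register `R + 3` holds the number of variables.  A list is longer than
`K` iff its `K`-th tail is not `nil`, which a single expression tests, since `K` is fixed. -/
def shortenStep (K R : ℕ) : Program :=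
  .seq
    (.cond (Expr.tl^[K] (.tl (.hd (.var (R + 1)))))
      (.assign (R + 2)
        (.cons (.cons (.hd (.hd (.var (R + 1)))) (freshLits (R + 3))) (.var (R + 2))))
      (.assign (R + 2) (.cons (.hd (.var (R + 1))) (.var (R + 2)))))
    (.assign (R + 1) (.tl (.var (R + 1))))

theorem Guarantees.shorten_loop {n K R T : ℕ} {k : List Program} {f : Store → ℝ} {v : ℝ}
    (cs : List (Clause n)) (acc : List Data) (s : Store)
    (h₁ : s (R + 1) = Data.ofList (cs.map encodeClause)) (h₂ : s (R + 2) = Data.ofList acc)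
    (h₃ : s (R + 3) = Data.unary n)
    (hk : ∀ s' : Store, (∀ i, i ≠ R + 1 → i ≠ R + 2 → s' i = s i) →
      s' (R + 2) =
        Data.ofList ((cs.map fun C => encodeClause (C.shorten K)).reverse ++ acc) →
      Guarantees T (k, s') f v) :
    Guarantees (T + 5 * cs.length + 1) (.loop (.var (R + 1)) (shortenStep K R) :: k, s) f v := by
  induction cs generalizing acc s with
  | nil =>
    refine .loop_neg (by simp [Expr.eval, h₁, Data.ofList]) ?_
    exact hk s (fun _ _ _ => rfl) (by simpa using h₂)
  | cons C cs ih =>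
    have h₁' : s (R + 1) = Data.cons (encodeClause C) (Data.ofList (cs.map encodeClause)) := h₁
    have hlen : (Expr.tl^[K] (.tl (.hd (.var (R + 1))))).eval s = BinaryTree.nil ↔
        C.lits.length ≤ K := by
      simp [Expr.eval_tl_iterate, Expr.eval, h₁', Data.cons, encodeClause, BinaryTree.left,
        BinaryTree.right, Data.right_iterate_ofList, Data.ofList_eq_nil]
    have hT : T + 5 * (C :: cs).length + 1 = (T + 5 * cs.length + 1) + 1 + 1 + 1 + 1 + 1 := by
      simp only [List.length_cons]
      ring
    rw [hT]
    have main : ∀ d : Data, d = encodeClause (C.shorten K) →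
        Guarantees (T + 5 * cs.length + 1 + 1) (.assign (R + 1) (.tl (.var (R + 1))) ::
          .loop (.var (R + 1)) (shortenStep K R) :: k,
          Function.update s (R + 2) (Data.cons d (s (R + 2)))) f v := by
      rintro d rfl
      refine .assign (ih (encodeClause (C.shorten K) :: acc) _ ?_ ?_ ?_ ?_)
      · simp [Expr.eval, h₁', Data.cons, BinaryTree.right]
      · simp [h₂, Data.ofList]
      · simp [h₃]
      · intro s' hs' hacc
        refine hk s' (fun i hi hi' => ?_) (by simpa using hacc)
        rw [hs' i hi hi', Function.update_of_ne hi, Function.update_of_ne hi']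
    refine .loop_pos (by simp [Expr.eval, h₁', Data.cons_ne_nil]) (.seq ?_)
    by_cases hl : C.lits.length ≤ K
    · refine .cond_neg (hlen.2 hl) (.assign (main _ ?_))
      rw [encodeClause_shorten, if_pos hl]
      simp [Expr.eval, h₁', Data.cons, BinaryTree.left]
    · refine .cond_pos (fun h => hl (hlen.1 h)) (.assign (main _ ?_))
      rw [encodeClause_shorten, if_neg hl]
      simp [Expr.eval, h₁', h₃, freshLits, Data.cons, BinaryTree.left, encodeClause, Data.ofList,
        Data.unary_succ]

/-- The program that replaces the instance in register `0` by the one with short clauses. -/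
def shortenProgram (K R : ℕ) : Program :=
  .seq (.assign (R + 1) (.tl (.var 0))) <|
  .seq (.assign (R + 3) (.hd (.var 0))) <|
  .seq (.loop (.var (R + 1)) (shortenStep K R)) <|
  .assign 0 (.cons (.cons .nil (.cons .nil (.var (R + 3)))) (.var (R + 2)))

theorem Guarantees.shortenProgram {K R T : ℕ} {k : List Program} {f : Store → ℝ} {v : ℝ}
    (Φ : Instance) (s : Store) (h₀ : s 0 = encode Φ) (h₂ : s (R + 2) = BinaryTree.nil)
    (hk : ∀ s' : Store, s' 0 = encode (Φ.shorten K) → (∀ i ≤ R, i ≠ 0 → s' i = s i) →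
      s' (R + 3) = Data.unary Φ.numVars → Guarantees T (k, s') f v) :
    Guarantees (T + 5 * Φ.clauses.length + 7) (MaxNAE.shortenProgram K R :: k, s) f v := by
  have hT : T + 5 * Φ.clauses.length + 7 =
    (T + 1 + 5 * Φ.clauses.length + 1) + 1 + 1 + 1 + 1 + 1 := by ring
  rw [hT]
  refine .seq (.assign (.seq (.assign (.seq (shorten_loop Φ.clauses [] _ ?_ ?_ ?_ ?_)))))
  · simp [Expr.eval, h₀, encode, Data.cons, BinaryTree.right]
  · simp [h₂, Data.ofList]
  · simp [Expr.eval, h₀, encode, Data.cons, BinaryTree.left]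
  · intro s' hs' hacc
    have h₃ : s' (R + 3) = Data.unary Φ.numVars := by
      rw [hs' _ (by simp) (by simp)]
      simp [Expr.eval, h₀, encode, Data.cons, BinaryTree.left]
    refine .assign (hk _ ?_ ?_ ?_)
    · simp [Expr.eval, h₃, hacc, encode, Instance.shorten, Data.unary_succ]
      rfl
    · intro i hi hi0
      rw [Function.update_of_ne hi0, hs' _ (by omega) (by omega),
        Function.update_of_ne (by omega), Function.update_of_ne (by omega)]
    · simp [h₃]

theorem Data.numNodes_unary (m : ℕ) : (Data.unary m).numNodes = m := by
  induction m with
  | zero => rfl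
  | succ m ih => simp [Data.unary_succ, Data.cons, ih]

theorem Data.numNodes_ofList (l : List Data) :
    (Data.ofList l).numNodes = (l.map fun d => d.numNodes + 1).sum := by
  induction l with
  | nil => rfl
  | cons a l ih =>
    simp only [Data.ofList, Data.cons, BinaryTree.numNodes, ih, List.map_cons, List.sum_cons]
    ring

theorem size_eq (Φ : Instance) : size Φ =
    Φ.numVars + (Φ.clauses.map fun C => (encodeClause C).numNodes + 1).sum + 1 := by
  simp [size, encode, Data.cons, Data.numNodes_unary, Data.numNodes_ofList, Function.comp_def]

theorem numVars_le_size (Φ : Instance) : Φ.numVars ≤ size Φ := by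
  rw [size_eq]
  omega

theorem length_clauses_le_size (Φ : Instance) : Φ.clauses.length ≤ size Φ := by
  rw [size_eq]
  have := List.length_le_sum_of_one_le (Φ.clauses.map fun C => (encodeClause C).numNodes + 1)
    (by simp)
  simp only [List.length_map] at this
  omega

theorem numNodes_encodeClause_shorten {n : ℕ} (K : ℕ) (C : Clause n) :
    (encodeClause (C.shorten K)).numNodes ≤ (encodeClause C).numNodes + (2 * n + 5) := by
  rw [encodeClause_shorten]
  split_ifs
  · omega
  · simp only [Data.ofList, Data.cons, BinaryTree.numNodes, Data.numNodes_unary, encodeClause]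
    omega

theorem size_shorten_le (K : ℕ) (Φ : Instance) :
    size (Φ.shorten K) ≤ 2 * size Φ ^ 2 + 6 * size Φ + 2 := by
  have h : ((Φ.shorten K).clauses.map fun C => (encodeClause C).numNodes + 1).sum ≤
      (Φ.clauses.map fun C => (encodeClause C).numNodes + 1).sum +
        Φ.clauses.length * (2 * Φ.numVars + 5) := by
    simp only [Instance.shorten, List.map_reverse, List.sum_reverse, List.map_map]
    generalize Φ.clauses = cs
    induction cs with
    | nil => simp
    | cons C cs ih =>
      have := numNodes_encodeClause_shorten K C
      simp only [List.map_cons, List.sum_cons, List.length_cons, Function.comp_apply] at ih ⊢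
      linarith
  have h' : Φ.clauses.length * (2 * Φ.numVars + 5) ≤ size Φ * (2 * size Φ + 5) :=
    Nat.mul_le_mul (length_clauses_le_size Φ) (by linarith [numVars_le_size Φ])
  have e := size_eq Φ
  have e' := size_eq (Φ.shorten K)
  have e'' : (Φ.shorten K).numVars = Φ.numVars + 2 := rfl
  linarith

/-! ### Random perturbation of the output -/

/-- Toss up to `j` coins and leave a non-`nil` tree in register `a` iff all of them show heads. -/
def allHeads (a : ℕ) : ℕ → Program
  | 0 => .assign a (.cons .nil .nil)
  | j + 1 => .seq (.flip a) (.cond (.var a) (allHeads a j) .skip)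

theorem Guarantees.allHeads {a T : ℕ} {k : List Program} {f : Store → ℝ} {v₀ v₁ : ℝ} (j : ℕ)
    (s : Store) (h₀ : Guarantees T (k, Function.update s a (Data.ofBool false)) f v₀)
    (h₁ : Guarantees T (k, Function.update s a (Data.ofBool true)) f v₁) :
    Guarantees (T + (3 * j + 1)) (MaxNAE.allHeads a j :: k, s) f
      ((1 / 2) ^ j * v₁ + (1 - (1 / 2) ^ j) * v₀) := by
  induction j generalizing s with
  | zero =>
    refine (Guarantees.assign (v := v₁) ?_).mono_value (by simp)
    exact h₁
  | succ j ih =>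
    have hT : T + (3 * (j + 1) + 1) = T + (3 * j + 1) + 1 + 1 + 1 := by ring
    rw [hT]
    refine .seq ((Guarantees.flip (v₀ := v₀) ?_ (.cond_pos ?_ (ih _ ?_ ?_))).mono_value
      (le_of_eq ?_))
    · refine .cond_neg ?_ (Guarantees.mono_time (T := T + 1) (.skip h₀) (by omega))
      simp [Expr.eval, Data.ofBool]
    · simp [Expr.eval, Data.ofBool, Data.cons]
    · simpa using h₀
    · simpa using h₁
    · rw [pow_succ]
      ring

/-- The entry of a tree read as an assignment, at variable `i`. -/
def Data.entry (d : Data) (i : ℕ) : Data :=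
  (BinaryTree.right^[i] d).left

theorem Data.entry_ofList (l : List Data) (i : ℕ) (hi : i < l.length) :
    (Data.ofList l).entry i = l[i] := by
  rw [Data.entry, Data.right_iterate_ofList, List.drop_eq_getElem_cons hi]
  rfl

/-- Move the first entry of the tree in register `0` onto the stack in register `R + 2`, and count
down the unary number in register `R + 5`.  A stack is needed because the perturbed list is built
from its last entry on. -/
def unstackStep (R : ℕ) : Program :=
  .seq (.assign (R + 2) (.cons (.hd (.var 0)) (.var (R + 2)))) <|
  .seq (.assign 0 (.tl (.var 0))) (.assign (R + 5) (.tl (.var (R + 5))))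

theorem Guarantees.unstack_loop {R T : ℕ} {k : List Program} {f : Store → ℝ} {v : ℝ}
    (m : ℕ) (acc : List Data) (s : Store)
    (h₂ : s (R + 2) = Data.ofList acc) (h₅ : s (R + 5) = Data.unary m)
    (hk : ∀ s' : Store, s' (R + 3) = s (R + 3) →
      s' (R + 2) =
        Data.ofList ((List.ofFn fun i : Fin m => (s 0).entry i).reverse ++ acc) →
      Guarantees T (k, s') f v) :
    Guarantees (T + 6 * m + 1) (.loop (.var (R + 5)) (unstackStep R) :: k, s) f v := by
  induction m generalizing acc s with
  | zero =>
    refine .loop_neg (by simp [Expr.eval, h₅, Data.unary, Data.ofList]) ?_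
    exact hk s rfl (by simpa using h₂)
  | succ m ih =>
    have hT : T + 6 * (m + 1) + 1 = (T + 6 * m + 1) + 1 + 1 + 1 + 1 + 1 + 1 := by ring
    rw [hT]
    refine .loop_pos (by simp [Expr.eval, h₅, Data.unary_succ, Data.cons_ne_nil])
      (.seq (.assign (.seq (.assign (.assign (ih ((s 0).entry 0 :: acc) _ ?_ ?_ ?_))))))
    · simp [Expr.eval, h₂, Data.ofList, Data.entry]
    · simp [Expr.eval, h₅, Data.unary_succ, Data.cons, BinaryTree.right]
    · intro s' h₃ hacc
      refine hk s' (by simpa using h₃) ?_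
      rw [hacc]
      simp [List.ofFn_succ, Expr.eval, Data.entry]

/-- The tree in an output list after the truth value that it stands for has been negated if
`b = true`. -/
def Data.toggle (d : Data) (b : Bool) : Data :=
  if b then Data.ofBool (decide (d = BinaryTree.nil)) else d

/-- The probability that a coin of bias `δ` has outcome `b`. -/
def biasedWeight (δ : ℝ) (b : Bool) : ℝ :=
  if b then δ else 1 - δ

/-- Move the top entry of the stack in register `R + 2` to the list in register `0`, negating it
with probability `2 ^ (-j)`, and count down the unary number in register `R + 3`. -/
def perturbStep (j R : ℕ) : Program :=
  .seq (allHeads (R + 4) j) <|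
  .seq (.cond (.var (R + 4))
    (.cond (.hd (.var (R + 2))) (.assign 0 (.cons .nil (.var 0)))
      (.assign 0 (.cons (.cons .nil .nil) (.var 0))))
    (.assign 0 (.cons (.hd (.var (R + 2))) (.var 0)))) <|
  .seq (.assign (R + 2) (.tl (.var (R + 2)))) (.assign (R + 3) (.tl (.var (R + 3))))

theorem sum_fin_snoc_bool (m : ℕ) (g : (Fin (m + 1) → Bool) → ℝ) :
    ∑ z, g z =
      ∑ z : Fin m → Bool, g (Fin.snoc z true) + ∑ z : Fin m → Bool, g (Fin.snoc z false) := by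
  rw [← (Fin.snocEquiv fun _ : Fin (m + 1) => Bool).sum_comp, Fintype.sum_prod_type,
    Fintype.sum_bool]
  rfl

theorem Guarantees.perturb_loop {R : ℕ} {g : Data → ℝ} (j m : ℕ) (x : Fin m → Data)
    (acc : List Data) (s : Store) (h₀ : s 0 = Data.ofList acc)
    (h₂ : s (R + 2) = Data.ofList (List.ofFn x).reverse) (h₃ : s (R + 3) = Data.unary m) :
    Guarantees ((3 * j + 10) * m + 1) ([.loop (.var (R + 3)) (perturbStep j R)], s)
      (fun s => g (s 0))
      (∑ z : Fin m → Bool, (∏ i, biasedWeight ((1 / 2) ^ j) (z i)) *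
        g (Data.ofList ((List.ofFn fun i => (x i).toggle (z i)) ++ acc))) := by
  induction m generalizing acc s with
  | zero =>
    refine .loop_neg (by simp [Expr.eval, h₃, Data.unary, Data.ofList]) (.halted ?_)
    simp [h₀]
  | succ m ih =>
    rw [List.ofFn_succ', List.concat_eq_append, List.reverse_concat] at h₂
    -- What happens once the outcome `b` of the biased coin is in register `R + 4`.
    have step : ∀ b : Bool, Guarantees ((3 * j + 10) * m + 1 + 7)
        (.seq (.cond (.var (R + 4))
          (.cond (.hd (.var (R + 2))) (.assign 0 (.cons .nil (.var 0)))
            (.assign 0 (.cons (.cons .nil .nil) (.var 0))))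
          (.assign 0 (.cons (.hd (.var (R + 2))) (.var 0))))
          (.seq (.assign (R + 2) (.tl (.var (R + 2)))) (.assign (R + 3) (.tl (.var (R + 3))))) ::
          [.loop (.var (R + 3)) (perturbStep j R)], Function.update s (R + 4) (Data.ofBool b))
        (fun s => g (s 0))
        (∑ z : Fin m → Bool, (∏ i, biasedWeight ((1 / 2) ^ j) (z i)) *
          g (Data.ofList ((List.ofFn fun i => (x i.castSucc).toggle (z i)) ++
            (x (Fin.last m)).toggle b :: acc))) := by
      intro b
      have tail : ∀ d : Data, d = (x (Fin.last m)).toggle b →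
          Guarantees ((3 * j + 10) * m + 1 + 3)
          (.seq (.assign (R + 2) (.tl (.var (R + 2)))) (.assign (R + 3) (.tl (.var (R + 3)))) ::
            [.loop (.var (R + 3)) (perturbStep j R)],
            Function.update (Function.update s (R + 4) (Data.ofBool b)) 0
              (Data.cons d (s 0)))
          (fun s => g (s 0))
          (∑ z : Fin m → Bool, (∏ i, biasedWeight ((1 / 2) ^ j) (z i)) *
            g (Data.ofList ((List.ofFn fun i => (x i.castSucc).toggle (z i)) ++
              (x (Fin.last m)).toggle b :: acc))) := by
        rintro d rfl
        refine .seq (.assign (.assign (ih _ _ _ ?_ ?_ ?_)))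
        · simp [h₀, Data.ofList]
        · simp [Expr.eval, h₂, Data.ofList, Data.cons, BinaryTree.right]
        · simp [Expr.eval, h₃, Data.unary_succ, Data.cons, BinaryTree.right]
      refine .seq ?_
      cases b with
      | false =>
        refine .cond_neg (by simp [Expr.eval, Data.ofBool]) (.assign ?_)
        -- The branch without negation is one step shorter than the other one.
        refine Guarantees.mono_time ?_ (Nat.le_succ _)
        convert tail _ rfl using 6
        simp [Expr.eval, h₂, Data.ofList, Data.cons, BinaryTree.left, Data.toggle]
      | true =>
        refine .cond_pos (by simp [Expr.eval, Data.ofBool, Data.cons]) ?_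
        by_cases hx : x (Fin.last m) = BinaryTree.nil
        · refine .cond_neg ?_ (.assign ?_)
          · simp [Expr.eval, h₂, hx, Data.ofList, Data.cons, BinaryTree.left]
          · convert tail _ rfl using 6
            simp [Expr.eval, Data.toggle, hx, Data.ofBool]
        · refine .cond_pos ?_ (.assign ?_)
          · simpa [Expr.eval, h₂, Data.ofList, Data.cons, BinaryTree.left] using hx
          · convert tail _ rfl using 6
            simp [Expr.eval, Data.toggle, hx, Data.ofBool]
    have hT : (3 * j + 10) * (m + 1) + 1 =
        (3 * j + 10) * m + 1 + 7 + (3 * j + 1) + 1 + 1 := by ring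
    rw [hT]
    refine .loop_pos (by simp [Expr.eval, h₃, Data.unary_succ, Data.cons_ne_nil])
      (.seq ((Guarantees.allHeads j s (step false) (step true)).mono_value (le_of_eq ?_)))
    rw [sum_fin_snoc_bool]
    simp only [Fin.prod_univ_castSucc, Fin.snoc_castSucc, Fin.snoc_last, List.ofFn_succ',
      List.concat_eq_append, List.append_assoc, List.singleton_append, Finset.mul_sum]
    congr 1 <;> refine Finset.sum_congr rfl fun z _ => ?_
    · simp only [biasedWeight]
      simp only [if_true]
      ring
    · simp only [biasedWeight]
      simp only [Bool.false_eq_true, if_false]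
      ring

/-- The program that negates each of the first entries of the tree in register `0`, as many as
register `R + 3` says in unary, independently with probability `2 ^ (-j)`. -/
def perturbProgram (j R : ℕ) : Program :=
  .seq (.assign (R + 2) .nil) <|
  .seq (.assign (R + 5) (.var (R + 3))) <|
  .seq (.loop (.var (R + 5)) (unstackStep R)) <|
  .seq (.assign 0 .nil) (.loop (.var (R + 3)) (perturbStep j R))

theorem Guarantees.perturbProgram {R n : ℕ} {g : Data → ℝ} (j : ℕ) (s : Store)
    (h₃ : s (R + 3) = Data.unary n) :
    Guarantees ((3 * j + 16) * n + 9) ([MaxNAE.perturbProgram j R], s) (fun s => g (s 0))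
      (∑ z : Fin n → Bool, (∏ i, biasedWeight ((1 / 2) ^ j) (z i)) *
        g (Data.ofList (List.ofFn fun i : Fin n => ((s 0).entry i).toggle (z i)))) := by
  have hT : (3 * j + 16) * n + 9 =
      ((3 * j + 10) * n + 1 + 1 + 1) + 6 * n + 1 + 1 + 1 + 1 + 1 + 1 := by ring
  rw [hT]
  refine .seq (.assign (.seq (.assign (.seq (unstack_loop n [] _ ?_ ?_ ?_)))))
  · simp [Expr.eval, Data.ofList]
  · simp [Expr.eval, h₃]
  · intro s' h₃' hacc
    refine .seq (.assign ?_)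
    have := perturb_loop (R := R) (g := g) j n (fun i : Fin n => (s 0).entry i) []
      (Function.update s' 0 (Expr.nil.eval s')) ?_ ?_ ?_
    · simpa using this
    · simp [Expr.eval, Data.ofList]
    · simpa using hacc
    · simpa [h₃] using h₃'

/-! ### Perturbed assignments satisfy clauses -/

/-- The probability of the event `E` over `n` independent coins of bias `δ`. -/
noncomputable def coinProb {n : ℕ} (δ : ℝ) (E : (Fin n → Bool) → Prop) [DecidablePred E] : ℝ :=
  ∑ z : Fin n → Bool, (∏ i, biasedWeight δ (z i)) * if E z then 1 else 0

section CoinProb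

variable {n : ℕ} {δ : ℝ} {E F G : (Fin n → Bool) → Prop} [DecidablePred E] [DecidablePred F]
  [DecidablePred G]

theorem biasedWeight_nonneg (h₀ : 0 ≤ δ) (h₁ : δ ≤ 1) (b : Bool) : 0 ≤ biasedWeight δ b := by
  cases b <;> simp [biasedWeight, h₀, h₁]

theorem biasedWeight_le (h : δ ≤ 1 / 2) (b : Bool) : biasedWeight δ b ≤ 1 - δ := by
  cases b <;> simp [biasedWeight]
  linarith

theorem coinProb_le_add (h₀ : 0 ≤ δ) (h₁ : δ ≤ 1) (h : ∀ z, E z → F z ∨ G z) :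
    coinProb δ E ≤ coinProb δ F + coinProb δ G := by
  rw [coinProb, coinProb, coinProb, ← Finset.sum_add_distrib]
  refine Finset.sum_le_sum fun z _ => ?_
  rw [← mul_add]
  refine mul_le_mul_of_nonneg_left ?_
    (Finset.prod_nonneg fun i _ => biasedWeight_nonneg h₀ h₁ _)
  have := h z
  by_cases hE : E z <;> by_cases hF : F z <;> by_cases hG : G z <;> simp_all

theorem coinProb_mono (h₀ : 0 ≤ δ) (h₁ : δ ≤ 1) (h : ∀ z, E z → F z) :
    coinProb δ E ≤ coinProb δ F := by
  refine Finset.sum_le_sum fun z _ => mul_le_mul_of_nonneg_left ?_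
    (Finset.prod_nonneg fun i _ => biasedWeight_nonneg h₀ h₁ _)
  have := h z
  by_cases hE : E z <;> by_cases hF : F z <;> simp_all

theorem coinProb_nonneg (h₀ : 0 ≤ δ) (h₁ : δ ≤ 1) : 0 ≤ coinProb δ E :=
  Finset.sum_nonneg fun z _ => mul_nonneg
    (Finset.prod_nonneg fun i _ => biasedWeight_nonneg h₀ h₁ _) (by split_ifs <;> simp)

/-- Prescribed outcomes of the coins in `s` have the product of their probabilities. -/
theorem coinProb_cylinder (s : Finset (Fin n)) (c : Fin n → Bool) :
    coinProb δ (fun z => ∀ i ∈ s, z i = c i) = ∏ i ∈ s, biasedWeight δ (c i) := by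
  have h : ∀ z : Fin n → Bool,
      (∏ i, biasedWeight δ (z i)) * (if ∀ i ∈ s, z i = c i then (1 : ℝ) else 0) =
        ∏ i, if i ∈ s → z i = c i then biasedWeight δ (z i) else 0 := by
    intro z
    split_ifs with hz
    · rw [mul_one]
      exact Finset.prod_congr rfl fun i _ => (if_pos (hz i)).symm
    · push Not at hz
      obtain ⟨i, hi, hzi⟩ := hz
      rw [mul_zero]
      exact (Finset.prod_eq_zero (Finset.mem_univ i) (if_neg fun h => hzi (h hi))).symm
  rw [coinProb, Finset.sum_congr rfl fun z _ => h z, ← Fintype.piFinset_univ,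
    ← Finset.prod_univ_sum (fun _ => Finset.univ)
      fun i b => if i ∈ s → b = c i then biasedWeight δ b else 0,
    ← Finset.prod_subset (Finset.subset_univ s)]
  · refine Finset.prod_congr rfl fun i hi => ?_
    cases hc : c i <;> simp [hi]
  · intro i _ hi
    simp [hi, biasedWeight]

theorem coinProb_true : coinProb δ (fun _ : Fin n → Bool => True) = 1 := by
  simpa using coinProb_cylinder (δ := δ) (∅ : Finset (Fin n)) fun _ => false

theorem one_sub_coinProb_not_le (h₀ : 0 ≤ δ) (h₁ : δ ≤ 1) :
    1 - coinProb δ (fun z => ¬ E z) ≤ coinProb δ E := by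
  have := coinProb_le_add (E := fun _ : Fin n → Bool => True) (F := E) (G := fun z => ¬ E z)
    h₀ h₁ fun z _ => em _
  rw [coinProb_true] at this
  linarith

end CoinProb

/-- The assignment `x` after the variables `i` with `z i = true` have been negated. -/
def perturb {n : ℕ} (x z : Fin n → Bool) : Fin n → Bool :=
  fun i => xor (x i) (z i)

/-- A satisfied clause has two literals of different values, and stays satisfied if neither of
their variables is negated. -/
theorem Clause.Sat.le_coinProb_perturb {n : ℕ} {δ : ℝ} (h₀ : 0 ≤ δ) (h₁ : δ ≤ 1) {C : Clause n}
    {x : Fin n → Bool} (hC : C.Sat x) :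
    1 - 2 * δ ≤ coinProb δ fun z => C.Sat (perturb x z) := by
  have hC' := hC
  simp only [Clause.Sat, not_forall] at hC'
  obtain ⟨l, hl, l', hl', hne⟩ := hC'
  refine le_trans ?_ (coinProb_mono
    (E := fun z => ∀ i ∈ ({l.1, l'.1} : Finset (Fin n)), z i = false) h₀ h₁ fun z hz hall => hne ?_)
  · rw [coinProb_cylinder]
    simp only [biasedWeight, Bool.false_eq_true, if_false, Finset.prod_const]
    calc 1 - 2 * δ ≤ (1 - δ) ^ 2 := by nlinarith [sq_nonneg δ]
      _ ≤ _ := pow_le_pow_of_le_one (by linarith) (by linarith) Finset.card_le_two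
  · have h := hall l hl l' hl'
    simpa [litValue, perturb, hz l.1 (by simp), hz l'.1 (by simp)] using h

/-- For each truth value, it is unlikely that all literals of a long clause take this value, since
the literals are independent and each takes it with probability at most `1 - δ`. -/
theorem Clause.le_coinProb_perturb {n : ℕ} {δ : ℝ} (h₀ : 0 ≤ δ) (h₁ : δ ≤ 1 / 2) (C : Clause n)
    (x : Fin n → Bool) :
    1 - 2 * (1 - δ) ^ C.lits.length ≤ coinProb δ fun z => C.Sat (perturb x z) := by
  have h₁' : δ ≤ 1 := h₁.trans (by norm_num)
  -- The variables of the literals are distinct, so the sign is a function of the variable.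
  let sign : Fin n → Bool := fun i => decide ((i, true) ∈ C.lits)
  have hsign : ∀ l ∈ C.lits, sign l.1 = l.2 := by
    rintro ⟨i, b⟩ hl
    cases b with
    | true => simpa [sign] using hl
    | false =>
      simp only [sign, decide_eq_false_iff_not]
      intro hl'
      simpa using List.inj_on_of_nodup_map C.nodup hl hl' rfl
  let vars : Finset (Fin n) := (C.lits.map Prod.fst).toFinset
  have hcard : vars.card = C.lits.length := by
    rw [List.toFinset_card_of_nodup C.nodup, List.length_map]
  let E : Bool → (Fin n → Bool) → Prop := fun b z => ∀ i ∈ vars, z i = xor b (xor (sign i) (x i))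
  have hE : ∀ b, coinProb δ (E b) ≤ (1 - δ) ^ C.lits.length := by
    intro b
    rw [coinProb_cylinder vars fun i => xor b (xor (sign i) (x i)), ← hcard, ← Finset.prod_const]
    exact Finset.prod_le_prod (fun i _ => biasedWeight_nonneg h₀ h₁' _)
      fun i _ => biasedWeight_le h₁ _
  have hnot : coinProb δ (fun z => ¬ C.Sat (perturb x z)) ≤
      coinProb δ (E true) + coinProb δ (E false) := by
    refine coinProb_le_add h₀ h₁' fun z hz => ?_
    simp only [Clause.Sat, not_not] at hz
    obtain ⟨l₀, hl₀⟩ := List.exists_mem_of_length_pos (lt_of_lt_of_le two_pos C.two_le_length)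
    have key : E (litValue (perturb x z) l₀) z := by
      intro i hi
      obtain ⟨l, hl, rfl⟩ := List.mem_map.1 (List.mem_toFinset.1 hi)
      rw [hsign l hl, ← hz l hl l₀ hl₀, litValue, perturb]
      cases l.2 <;> cases x l.1 <;> cases z l.1 <;> rfl
    cases hb : litValue (perturb x z) l₀ <;> rw [hb] at key
    · exact Or.inr key
    · exact Or.inl key
  have := one_sub_coinProb_not_le (E := fun z => C.Sat (perturb x z)) h₀ h₁'
  linarith [hE true, hE false]

/-! ### The value of the original instance -/

theorem Clause.shorten_sat_of_le {n K : ℕ} {C : Clause n} (hC : C.lits.length ≤ K)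
    (x : Fin (n + 2) → Bool) : (C.shorten K).Sat x ↔ C.Sat fun i => x (Fin.castAdd 2 i) := by
  have h : (C.shorten K).lits = C.lits.map fun l => (Fin.castAdd 2 l.1, l.2) := if_pos hC
  simp only [Clause.Sat, h, List.forall_mem_map]
  rfl

theorem Clause.shorten_sat_of_lt {n K : ℕ} {C : Clause n} (hC : K < C.lits.length)
    (x : Fin (n + 2) → Bool) :
    (C.shorten K).Sat x ↔ x (Fin.natAdd n 0) ≠ x (Fin.natAdd n 1) := by
  simp [Clause.Sat, Clause.shorten, hC.not_ge, litValue, eq_comm]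

/-- The bounds on the bias `δ` and the length `K` with which the perturbation costs at most `ε`:
the first is used for short clauses, the second for long ones. -/
structure GoodNoise (δ : ℝ) (K : ℕ) (ε : ℝ) : Prop where
  nonneg : 0 ≤ δ
  le_half : δ ≤ 1 / 2
  short : 2 * δ ≤ ε
  long : 2 * (1 - δ) ^ K ≤ ε

/-- The probability that the perturbed assignment satisfies a clause falls short by at most `ε` of
whether the original assignment satisfies the shortened clause. -/
theorem GoodNoise.clause {δ ε : ℝ} {K n : ℕ} (h : GoodNoise δ K ε) (C : Clause n)
    (x : Fin (n + 2) → Bool) :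
    (if (C.shorten K).Sat x then 1 else 0) - ε ≤
      coinProb δ fun z => C.Sat (perturb (fun i => x (Fin.castAdd 2 i)) z) := by
  have h₀ := h.nonneg
  have h₁ : δ ≤ 1 := h.le_half.trans (by norm_num)
  have hs := h.short
  rcases le_or_gt C.lits.length K with hC | hC
  · simp only [Clause.shorten_sat_of_le hC]
    split_ifs with hx
    · linarith [hx.le_coinProb_perturb h₀ h₁]
    · exact le_trans (by linarith) (coinProb_nonneg h₀ h₁)
  · have hpow : (1 - δ) ^ C.lits.length ≤ (1 - δ) ^ K :=
      pow_le_pow_of_le_one (by linarith) (by linarith) hC.le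
    have hl := h.long
    refine le_trans ?_ (C.le_coinProb_perturb h₀ h.le_half _)
    split_ifs <;> linarith

theorem Instance.satWeight_eq (Φ : Instance) (x : Fin Φ.numVars → Bool) :
    Φ.satWeight x = (Φ.clauses.map fun C => if C.Sat x then C.weight else 0).sum := by
  rw [Instance.satWeight]
  generalize Φ.clauses = cs
  induction cs with
  | nil => rfl
  | cons C cs ih => by_cases h : C.Sat x <;> simp [h, ih]

theorem Instance.totalWeight_pos (Φ : Instance) : 0 < Φ.totalWeight := by
  obtain ⟨C, hC⟩ := List.exists_mem_of_ne_nil _ Φ.clauses_ne_nil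
  exact C.weight_pos.trans_le (List.single_le_sum (by simp) _ (List.mem_map_of_mem hC))

theorem Instance.totalWeight_shorten (K : ℕ) (Φ : Instance) :
    (Φ.shorten K).totalWeight = Φ.totalWeight := by
  simp only [Instance.totalWeight, Instance.shorten, List.map_reverse, List.sum_reverse,
    List.map_map]
  rfl

theorem Instance.satWeight_shorten (K : ℕ) (Φ : Instance) (x : Fin (Φ.numVars + 2) → Bool) :
    (Φ.shorten K).satWeight x =
      (Φ.clauses.map fun C => if (C.shorten K).Sat x then C.weight else 0).sum := by
  refine ((Φ.shorten K).satWeight_eq x).trans ?_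
  change (((Φ.clauses.map (Clause.shorten K)).reverse).map
    fun C => if C.Sat x then C.weight else 0).sum = _
  rw [List.map_reverse, List.sum_reverse, List.map_map]
  rfl

theorem GoodNoise.clauses {δ ε : ℝ} {K n : ℕ} (h : GoodNoise δ K ε) (cs : List (Clause n))
    (x : Fin (n + 2) → Bool) :
    ((cs.map fun C => if (C.shorten K).Sat x then C.weight else 0).sum : ℕ) -
        ε * ((cs.map Clause.weight).sum : ℕ) ≤
      ∑ z : Fin n → Bool, (∏ i, biasedWeight δ (z i)) *
        ((cs.map fun C => if C.Sat (perturb (fun i => x (Fin.castAdd 2 i)) z)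
          then C.weight else 0).sum : ℕ) := by
  induction cs with
  | nil => simp
  | cons C cs ih =>
    have hC := mul_le_mul_of_nonneg_left (h.clause C x) (Nat.cast_nonneg (α := ℝ) C.weight)
    simp only [List.map_cons, List.sum_cons, Nat.cast_add, mul_add, Finset.sum_add_distrib]
    refine le_trans (le_of_eq ?_) (add_le_add (hC.trans (le_of_eq ?_)) ih)
    · split_ifs <;> push_cast <;> ring
    · rw [coinProb, Finset.mul_sum]
      refine Finset.sum_congr rfl fun z _ => ?_
      split_ifs <;> push_cast <;> ring

/-- The expected value of the perturbation of an assignment, restricted to the original variables,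
is at most `ε` below the value that the assignment has on the shortened instance. -/
theorem GoodNoise.value {δ ε : ℝ} {K : ℕ} (h : GoodNoise δ K ε) (Φ : Instance)
    (x : Fin (Φ.numVars + 2) → Bool) :
    (Φ.shorten K).value x - ε ≤ ∑ z : Fin Φ.numVars → Bool, (∏ i, biasedWeight δ (z i)) *
      Φ.value (perturb (fun i => x (Fin.castAdd 2 i)) z) := by
  have hW : (0 : ℝ) < Φ.totalWeight := Nat.cast_pos.2 Φ.totalWeight_pos
  have key := h.clauses Φ.clauses x
  simp only [Instance.value, Instance.totalWeight_shorten, Instance.satWeight_shorten,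
    Instance.satWeight_eq Φ]
  simp only [← mul_div_assoc, ← Finset.sum_div]
  rw [div_sub' hW.ne', div_le_div_iff_of_pos_right hW]
  rw [mul_comm]
  exact key

theorem Instance.opt_le_opt_shorten (K : ℕ) (Φ : Instance) : Φ.opt ≤ (Φ.shorten K).opt := by
  refine ciSup_le fun x => ?_
  -- The additional variables take different values, so that the replaced clauses are satisfied.
  let y : Fin (Φ.numVars + 2) → Bool := Fin.append x ![false, true]
  refine le_trans ?_
    (le_ciSup (f := fun y => (Φ.shorten K).value y) (Set.finite_range _).bddAbove y)
  simp only [Instance.value, Instance.totalWeight_shorten]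
  refine div_le_div_of_nonneg_right (Nat.cast_le.2 ?_) (Nat.cast_nonneg _)
  rw [Instance.satWeight_shorten, Instance.satWeight_eq]
  refine List.sum_le_sum fun C _ => ?_
  rcases le_or_gt C.lits.length K with hC | hC
  · have hy : (fun i => y (Fin.castAdd 2 i)) = x := by
      funext i
      simp [y]
    simp only [Clause.shorten_sat_of_le hC, hy, le_refl]
  · rw [if_pos ((Clause.shorten_sat_of_lt hC y).2 (by simp only [y, Fin.append_right]; simp))]
    split_ifs <;> simp

/-! ### From bounded to unbounded clause length -/

theorem decodeAssignment_toggle {n : ℕ} (d : Data) (z : Fin n → Bool) :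
    decodeAssignment n (Data.ofList (List.ofFn fun i : Fin n => (d.entry i).toggle (z i))) =
      perturb (decodeAssignment n d) z := by
  funext i
  have h : (Data.ofList (List.ofFn fun i : Fin n => (d.entry i).toggle (z i))).entry i =
      (d.entry i).toggle (z i) := by
    rw [Data.entry_ofList _ _ (by simp)]
    simp
  change decide (Data.entry _ i ≠ BinaryTree.nil) = xor (decide (d.entry i ≠ BinaryTree.nil)) (z i)
  rw [h]
  cases z i with
  | false => simp [Data.toggle]
  | true =>
    by_cases hd : d.entry i = BinaryTree.nil <;> simp [Data.toggle, hd, Data.ofBool, Data.cons]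

theorem eval_mono (p : Polynomial ℕ) : Monotone fun m : ℕ => p.eval m := by
  intro a b hab
  simp only [Polynomial.eval_eq_sum, Polynomial.sum]
  exact Finset.sum_le_sum fun i _ => Nat.mul_le_mul_left _ (Nat.pow_le_pow_left hab i)

/-- The algorithm for clauses of all lengths: replace the long clauses, run the algorithm `P` for
clauses of bounded length, and perturb its output. -/
def composite (K j R : ℕ) (P : Program) : Program :=
  .seq (shortenProgram K R) (.seq P (perturbProgram j R))

theorem guarantees_composite {P : Program} {K j R T : ℕ} {ε : ℝ} (hP : P.Bounded R)
    (h : GoodNoise ((1 / 2) ^ j) K ε) (Φ : Instance) (hT : HaltsWithin P (encode (Φ.shorten K)) T) :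
    Guarantees (T + ((3 * j + 16) * Φ.numVars + 9) + 1 + 5 * Φ.clauses.length + 7 + 1)
      (start (composite K j R P) (encode Φ))
      (fun s => Φ.value (decodeAssignment Φ.numVars (s 0)))
      (expectedValue P (Φ.shorten K) T - ε) := by
  have hrun : Guarantees T (start P (encode (Φ.shorten K)))
      (fun s => (Φ.shorten K).value (decodeAssignment (Φ.shorten K).numVars (s 0)) - ε)
      (expectedValue P (Φ.shorten K) T - ε) := by
    refine guarantees_iff.2 ⟨hT, le_of_eq ?_⟩
    rw [Finset.sum_sub_distrib, sub_div]
    congr 1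
    simp
  refine .seq (.shortenProgram Φ _ (by simp) (by simp) fun s h₀ hlow h₃ => .seq ?_)
  refine hrun.frame (k₀ := [P]) (k := [perturbProgram j R]) (R := R) (by simpa using hP) ?_ ?_
  · intro i hi
    by_cases hi0 : i = 0
    · simp [hi0, h₀]
    · rw [hlow i hi hi0, Function.update_of_ne hi0, Function.update_of_ne hi0]
  · intro s₀' s' hlow' hhigh
    refine (Guarantees.perturbProgram (g := fun d => Φ.value (decodeAssignment Φ.numVars d)) j s'
      ((hhigh _ (by omega)).trans h₃)).mono_value ?_
    simp only [decodeAssignment_toggle]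
    rw [hlow' 0 (Nat.zero_le R)]
    exact h.value Φ _

/-- Soundness `s` for clauses of length at most `K` gives soundness `s - ε` for all lengths. -/
theorem GoodNoise.achieves {K j : ℕ} {c s ε : ℝ} (h : GoodNoise ((1 / 2) ^ j) K ε) (hK : 2 ≤ K)
    (hs : Achieves (boundedNAE K) c s) : Achieves uniformNAE c (s - ε) := by
  obtain ⟨P, time, hhalt, hval⟩ := hs
  obtain ⟨R, hR⟩ := P.exists_bounded
  let time' : Polynomial ℕ :=
    time.comp (2 * Polynomial.X ^ 2 + 6 * Polynomial.X + 2) +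
      Polynomial.C (3 * j + 21) * Polynomial.X + Polynomial.C 18
  have key : ∀ Φ : Instance, Guarantees (time'.eval (size Φ))
      (start (composite K j R P) (encode Φ))
      (fun s => Φ.value (decodeAssignment Φ.numVars (s 0)))
      (expectedValue P (Φ.shorten K) (time.eval (size (Φ.shorten K))) - ε) := by
    intro Φ
    refine (guarantees_composite hR h Φ
      (hhalt _ (Φ.shorten_mem_boundedNAE hK))).mono_time ?_
    have h₁ := eval_mono time (size_shorten_le K Φ)
    have h₂ := numVars_le_size Φ
    have h₃ := length_clauses_le_size Φ
    have h₄ : (3 * j + 16) * Φ.numVars ≤ (3 * j + 16) * size Φ := Nat.mul_le_mul_left _ h₂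
    have h₅ : time'.eval (size Φ) = time.eval (2 * size Φ ^ 2 + 6 * size Φ + 2) +
        (3 * j + 21) * size Φ + 18 := by
      simp [time', Polynomial.eval_comp]
    simp only at h₁
    rw [h₅]
    linarith
  refine ⟨composite K j R P, time', fun Φ _ => (guarantees_iff.1 (key Φ)).1, fun Φ _ hc => ?_⟩
  refine le_trans ?_ (guarantees_iff.1 (key Φ)).2
  have := hval _ (Φ.shorten_mem_boundedNAE hK) (hc.trans (Φ.opt_le_opt_shorten K))
  linarith

theorem exists_goodNoise {ε : ℝ} (hε : 0 < ε) : ∃ j K, 2 ≤ K ∧ GoodNoise ((1 / 2) ^ j) K ε := by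
  obtain ⟨j, hj⟩ := exists_pow_lt_of_lt_one (half_pos hε) (by norm_num : (1 / 2 : ℝ) < 1)
  have hle : (1 / 2 : ℝ) ^ (j + 1) ≤ (1 / 2) ^ j :=
    pow_le_pow_of_le_one (by norm_num) (by norm_num) (Nat.le_succ j)
  have hpos : (0 : ℝ) < (1 / 2) ^ (j + 1) := by positivity
  have hhalf : (1 / 2 : ℝ) ^ (j + 1) ≤ 1 / 2 := pow_le_of_le_one (by norm_num) (by norm_num) (by simp)
  obtain ⟨K, hK⟩ := exists_pow_lt_of_lt_one (half_pos hε)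
    (by linarith : 1 - (1 / 2 : ℝ) ^ (j + 1) < 1)
  have hK' : (1 - (1 / 2 : ℝ) ^ (j + 1)) ^ (K + 2) ≤ (1 - (1 / 2) ^ (j + 1)) ^ K :=
    pow_le_pow_of_le_one (by linarith) (by linarith) (by omega)
  -- The exponent `j + 1` ensures that the bias is at most `1 / 2`; the new clauses have length 2.
  exact ⟨j + 1, K + 2, by omega, hpos.le, hhalf, by linarith, by linarith⟩

theorem Achieves.mono {Λ Λ' : Set Instance} {c s : ℝ} (h : Λ ⊆ Λ') (hs : Achieves Λ' c s) :
    Achieves Λ c s := by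
  obtain ⟨P, time, h₁, h₂⟩ := hs
  exact ⟨P, time, fun Φ hΦ => h₁ Φ (h hΦ), fun Φ hΦ => h₂ Φ (h hΦ)⟩

theorem bestSoundness_nonneg (Λ : Set Instance) (c : ℝ) : 0 ≤ bestSoundness Λ c :=
  Real.sSup_nonneg fun _ hs => hs.1.1

theorem le_bestSoundness {Λ : Set Instance} {c s : ℝ} (hs : s ∈ Set.Icc (0 : ℝ) 1)
    (h : Achieves Λ c s) : s ≤ bestSoundness Λ c :=
  le_csSup ⟨1, fun _ ht => ht.1.2⟩ ⟨hs, h⟩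

theorem bestSoundness_anti {Λ Λ' : Set Instance} {c : ℝ} (h : Λ ⊆ Λ') :
    bestSoundness Λ' c ≤ bestSoundness Λ c :=
  Real.sSup_le (fun _ hs => le_bestSoundness hs.1 (hs.2.mono h)) (bestSoundness_nonneg _ _)

theorem GoodNoise.bestSoundness_le {K j : ℕ} {ε : ℝ} (h : GoodNoise ((1 / 2) ^ j) K ε)
    (hK : 2 ≤ K) (c : ℝ) :
    bestSoundness (boundedNAE K) c ≤ bestSoundness uniformNAE c + ε := by
  have hU := bestSoundness_nonneg uniformNAE c
  have hε : 0 ≤ ε := le_trans (by positivity) h.short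
  refine Real.sSup_le (fun s hs => ?_) (by linarith)
  rcases le_total s ε with hsε | hsε
  · linarith
  · have := le_bestSoundness ⟨sub_nonneg.2 hsε, by linarith [hs.1.2]⟩ (h.achieves hK hs.2)
    linarith

end MaxNAE

theorem mainTheorem6 (c : ℝ) (hc : c ∈ Set.Icc (0 : ℝ) 1) :
    Tendsto (fun k : ℕ => MaxNAE.bestSoundness (MaxNAE.boundedNAE k) c) atTop
      (𝓝 (MaxNAE.bestSoundness MaxNAE.uniformNAE c)) := by
  refine Metric.tendsto_atTop.2 fun ε hε => ?_
  obtain ⟨j, K, hK, h⟩ := MaxNAE.exists_goodNoise (half_pos hε)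
  refine ⟨K, fun k hk => ?_⟩
  have h₁ : MaxNAE.bestSoundness MaxNAE.uniformNAE c ≤
      MaxNAE.bestSoundness (MaxNAE.boundedNAE k) c :=
    MaxNAE.bestSoundness_anti (Set.subset_univ _)
  have h₂ : MaxNAE.bestSoundness (MaxNAE.boundedNAE k) c ≤
      MaxNAE.bestSoundness (MaxNAE.boundedNAE K) c :=
    MaxNAE.bestSoundness_anti fun Φ hΦ C hC => (hΦ C hC).trans hk
  have h₃ := h.bestSoundness_le hK c
  rw [Real.dist_eq, abs_lt]
  constructor <;> linarith
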